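/- Let $\mathbb F$ be a finite field. A deterministic bilinear query algorithm accesses an unknown matrix $X\in\mathbb F^{n\times m}$ by adaptively chosen queries, each of which reveals $u^{\mathsf T}Xv\in\mathbb F$ for vectors $u\in\mathbb F^n$, $v\in\mathbb F^m$ of the algorithm's choosing, and then outputs $-1$ or $1$. A randomized algorithm is a probability distribution on deterministic ones; its cost is the maximum number of queries in any execution. For a partial function $f\colon\mathbb F^{n\times m}\to\{-1,1,*\}$, let $\mathrm{BLQ}_\epsilon(f)$ be the minimum cost of a randomized algorithm that, on every $X$ with $f(X)\neq *$, outputs $f(X)$ with probability at least $1-\epsilon$. Let - $\mathrm{Rank}^{\mathbb F,n,m}_{r,R}(X)$ be $-1$ if $\operatorname{rk}X=r$, $1$ if $\operatorname{rk}X=R$, and $*$ otherwise; - $\mathrm{Det}^{\mathbb F,n}_{a,b}(X)$ be $-1$ if $\det X=a$, $1$ if $\det X=b$, and $*$ otherwise; - $\mathrm{RankDet}^{\mathbb F,n}_{r,a}(X)$ be $-1$ if $\operatorname{rk}X=r$, $1$ if $\det X=a$, and $*$ otherwise, where in the last two cases $m=n$. Theorem 1.15. There is an absolute constant $c>0$ such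 that for every finite field $\mathbb F$: 1. for all integers $n,m,R,r$ with $\min\{n,m\}\ge R>r\ge 0$, $$\mathrm{BLQ}_{\frac12-\frac1{4|\mathbb F|^{r/3}}}\bigl(\mathrm{Rank}^{\mathbb F,n,m}_{r,R}\bigr)\ \ge\ c\,(r^2+1);$$ 2. for all distinct $a,b\in\mathbb F$ and all integers $n\ge 1$, $$\mathrm{BLQ}_{\frac12-\frac1{4|\mathbb F|^{(n-1)/3}}}\bigl(\mathrm{Det}^{\mathbb F,n}_{a,b}\bigr)\ \ge\ c\,n^2;$$ 3. for all $a\in\mathbb F\setminus\{0\}$ and all integers $n>r\ge 0$, $$\mathrm{BLQ}_{\frac12-\frac1{4|\mathbb F|^{r/3}}}\bigl(\mathrm{RankDet}^{\mathbb F,n}_{r,a}\bigr)\ \ge\ c\,(r^2+1).$$ -/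

import Mathlib

open Matrix

/-- Deterministic (adaptive) query algorithms in the bilinear query model, for an unknown
`n × m` matrix over `F`: a decision tree that either stops with an output in `{-1, 1}`, or asks
for `uᵀ X v` and continues in a way that may depend on the answer. -/
inductive BilinearAlg (F : Type*) (n m : ℕ) where
  | output (y : ℤˣ) : BilinearAlg F n m
  | query (u : Fin n → F) (v : Fin m → F) (next : F → BilinearAlg F n m) : BilinearAlg F n m

namespace BilinearAlg

variable {F : Type*} [Field F] {n m : ℕ}

/-- The output of a deterministic algorithm on input `X`. -/
def run : BilinearAlg F n m → Matrix (Fin n) (Fin m) F → ℤˣ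
  | output y, _ => y
  | query u v next, X => (next (u ⬝ᵥ (X *ᵥ v))).run X

/-- The number of queries made by a deterministic algorithm in its execution on input `X`. -/
def numQueries : BilinearAlg F n m → Matrix (Fin n) (Fin m) F → ℕ
  | output _, _ => 0
  | query u v next, X => (next (u ⬝ᵥ (X *ᵥ v))).numQueries X + 1

end BilinearAlg

/-- A partial Boolean function on `n × m` matrices over `F`, with values `-1`, `1` or
`*` (rendered as `none`, meaning outside the domain). -/
abbrev PartialMatrixFun (F : Type*) (n m : ℕ) : Type _ :=
  Matrix (Fin n) (Fin m) F → Option ℤˣ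

/-- A randomized query algorithm is a probability distribution `p` on deterministic query
algorithms. (Over a finite field there are only countably many deterministic algorithms, so every
probability distribution on them is given by its mass function.)
It computes `f` with error at most `ε` if, on every input in the domain of `f`,
the probability of an output different from the value of `f` is at most `ε`. -/
def ComputesWithError {F : Type*} [Field F] {n m : ℕ}
    (p : PMF (BilinearAlg F n m)) (f : PartialMatrixFun F n m) (ε : ℝ) : Prop :=
  ∀ (X : Matrix (Fin n) (Fin m) F) (y : ℤˣ), f X = some y →
    (p.toOuterMeasure {t | t.run X ≠ y}).toReal ≤ ε

/-- A randomized query algorithm has cost at most `c` if it makes at most `c` queries in every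
possible execution. -/
def CostAtMost {F : Type*} [Field F] {n m : ℕ}
    (p : PMF (BilinearAlg F n m)) (c : ℕ) : Prop :=
  ∀ t ∈ p.support, ∀ X : Matrix (Fin n) (Fin m) F, t.numQueries X ≤ c

/-- The `ε`-error bilinear query complexity of `f`: the minimum cost of a randomized bilinear query
algorithm that computes `f` with error at most `ε`. The minimum exists for all `ε ≥ 0`,
see `exists_randomized_bilinearAlg`. -/
noncomputable def BLQ {F : Type*} [Field F] {n m : ℕ} (ε : ℝ) (f : PartialMatrixFun F n m) : ℕ :=
  sInf {c : ℕ | ∃ p : PMF (BilinearAlg F n m), CostAtMost p c ∧ ComputesWithError p f ε}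

theorem BilinearAlg.exists_read {F : Type*} [Field F] {n m : ℕ} (l : List (Fin n × Fin m)) :
    ∀ g : List F → ℤˣ, ∃ t : BilinearAlg F n m, ∀ X : Matrix (Fin n) (Fin m) F,
      t.run X = g (l.map fun e => X e.1 e.2) ∧ t.numQueries X = l.length := by
  induction l with
  | nil => exact fun g => ⟨.output (g []), fun X => ⟨rfl, rfl⟩⟩
  | cons e l ih =>
    intro g
    choose t ht using fun a : F => ih fun L => g (a :: L)
    refine ⟨.query (Pi.single e.1 1) (Pi.single e.2 1) t, fun X => ?_⟩
    simp [BilinearAlg.run, BilinearAlg.numQueries, ht]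

/-- Reading all `n * m` entries computes any function without error, so the set over which `BLQ`
takes the minimum is not empty. -/
theorem exists_randomized_bilinearAlg {F : Type*} [Field F] {n m : ℕ} {ε : ℝ} (hε : 0 ≤ ε)
    (f : PartialMatrixFun F n m) :
    ∃ p : PMF (BilinearAlg F n m), CostAtMost p (n * m) ∧ ComputesWithError p f ε := by
  classical
  let l : List (Fin n × Fin m) := Finset.univ.toList
  let r : Matrix (Fin n) (Fin m) F → List F := fun X => l.map fun e => X e.1 e.2
  have hr : Function.Injective r := by
    intro X Y h
    ext i j
    exact List.map_inj_left.1 h (i, j) (by simp [l])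
  obtain ⟨t, ht⟩ := BilinearAlg.exists_read l fun L => (f (Function.invFun r L)).getD 1
  refine ⟨PMF.pure t, ?_, ?_⟩
  · intro s hs X
    rw [PMF.support_pure, Set.mem_singleton_iff] at hs
    subst hs
    rw [(ht X).2]
    simp [l]
  · intro X y hy
    have h : t.run X = y := by
      rw [(ht X).1]
      change (f (Function.invFun r (r X))).getD 1 = y
      rw [Function.leftInverse_invFun hr X, hy]
      rfl
    rw [PMF.toOuterMeasure_pure_apply]
    simpa [h] using hε

open Classical in
/-- The matrix function of the rank problem: `-1` on matrices of rank `r`, `1` on matrices of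
rank `R`, undefined elsewhere. -/
noncomputable def rankFun (F : Type*) [Field F] (n m r R : ℕ) : PartialMatrixFun F n m := fun X =>
  if X.rank = r then some (-1) else if X.rank = R then some 1 else none

open Classical in
/-- The matrix function of the determinant problem: `-1` on matrices of determinant `a`, `1` on
matrices of determinant `b`, undefined elsewhere. -/
noncomputable def detFun {F : Type*} [Field F] (n : ℕ) (a b : F) : PartialMatrixFun F n n := fun X =>
  if X.det = a then some (-1) else if X.det = b then some 1 else none

open Classical in
/-- The matrix function of the rank versus determinant problem: `-1` on matrices of rank `r`, `1`
on matrices of determinant `a`, undefined elsewhere. -/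
noncomputable def rankDetFun {F : Type*} [Field F] (n r : ℕ) (a : F) : PartialMatrixFun F n n :=
  fun X => if X.rank = r then some (-1) else if X.det = a then some 1 else none

/-! Write Q = |F| and take the random input U D V, with U, V uniform in the special linear group.
Its rank and determinant are those of D, so one averaging scheme serves all three problems. It
suffices that no deterministic tree with q queries tells a full-rank D = E from the rank-r matrix
`partialOne F N r`.

The Fourier coefficient of this distribution at a frequency A is `sphericalAverage χ A D`. Two facts
control it. If A has rank k < N, it is a polynomial of degree at most k in Q^(-rank D)
(`exists_polynomial_sphericalAverage`). In general its modulus is at most 4Q · Q^(-rank A · rank D /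
2) (`norm_sphericalAverage_sq_le`).

Interpolation (`exists_interpolation_weights`) corrects the difference of the two distributions by
orbits of ranks somewhat below r, with total weight O(Q^(-r/3)), so that the coefficients at all
frequencies of rank at most r/6 vanish. At the other frequencies all ranks involved are of order r,
so the coefficients are Q^(-Ω(r²)). A tree with q queries gains at most a factor Q^q over the
largest coefficient (`BilinearAlg.norm_sum_run_le`), so q ≤ r²/3600 leaves an advantage below the
allowed one (`abs_orbitProb_sub_orbitProb_le`). Averaging over the randomized algorithm finishes the
proof (`lt_BLQ`). -/

section LinearAlgebra

/-! ### Orbits of matrices under two-sided multiplication, and counts of solutions. -/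

variable {F : Type*} [Field F] {N : ℕ}

theorem Matrix.exists_isUnit_mul_mul_eq_of_rank_eq {M M' : Matrix (Fin N) (Fin N) F}
    (h : M.rank = M'.rank) : ∃ P Q, IsUnit P ∧ IsUnit Q ∧ P * M * Q = M' := by
  obtain ⟨V, U, e, hV, hU, hM⟩ := M.exists_rank_normal_form
  obtain ⟨V', U', e', hV', hU', hM'⟩ := M'.exists_rank_normal_form
  revert e'
  rw [← h]
  intro e' hM'
  -- The two normal forms differ only in how the indices are split into blocks; σ relabels one
  -- splitting into the other.
  set σ : Equiv.Perm (Fin N) := e'.trans e.symm with hσ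
  have key : V' * M' * U' = (σ.permMatrix F) * (V * M * U) * ((σ⁻¹ : Equiv.Perm (Fin N)).permMatrix F) := by
    rw [hM, hM', PEquiv.toMatrix_toPEquiv_mul, PEquiv.mul_toMatrix_toPEquiv, submatrix_submatrix,
      submatrix_submatrix]
    have h1 : ∀ i, e' i = e (σ i) := fun i => by simp [hσ]
    congr 1 <;> ext i <;> exact h1 i
  obtain ⟨v, rfl⟩ := hV'
  obtain ⟨u, rfl⟩ := hU'
  have hp : ∀ τ : Equiv.Perm (Fin N), IsUnit (τ.permMatrix F) := fun τ => by
    rw [isUnit_iff_isUnit_det, det_permutation]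
    exact (τ.sign.isUnit).map (Int.castRingHom F)
  refine ⟨(↑v⁻¹ : Matrix (Fin N) (Fin N) F) * σ.permMatrix F * V,
    U * (σ⁻¹ : Equiv.Perm (Fin N)).permMatrix F * (↑u⁻¹ : Matrix (Fin N) (Fin N) F),
    (v⁻¹.isUnit.mul (hp σ)).mul hV, (hU.mul (hp σ⁻¹)).mul u⁻¹.isUnit, ?_⟩
  have h1 : (↑v⁻¹ : Matrix (Fin N) (Fin N) F) * (v : Matrix (Fin N) (Fin N) F) = 1 := v.inv_mul
  have h2 : (u : Matrix (Fin N) (Fin N) F) * (↑u⁻¹ : Matrix (Fin N) (Fin N) F) = 1 := u.mul_inv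
  calc _ = (↑v⁻¹ : Matrix (Fin N) (Fin N) F) *
        (σ.permMatrix F * (V * M * U) * (σ⁻¹ : Equiv.Perm (Fin N)).permMatrix F) *
        (↑u⁻¹ : Matrix (Fin N) (Fin N) F) := by simp only [Matrix.mul_assoc]
    _ = (↑v⁻¹ : Matrix (Fin N) (Fin N) F) * (v : Matrix (Fin N) (Fin N) F) * M' *
        ((u : Matrix (Fin N) (Fin N) F) * (↑u⁻¹ : Matrix (Fin N) (Fin N) F)) := by
        rw [← key]; simp only [Matrix.mul_assoc]
    _ = M' := by rw [h1, h2, Matrix.one_mul, Matrix.mul_one]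

/-- A singular M has a left null vector y, so 1 + x yᵀ fixes M for every x, while its determinant 1
+ y·x can be prescribed. -/
theorem Matrix.exists_det_eq_and_mul_eq_self {M : Matrix (Fin N) (Fin N) F} (h : M.rank < N)
    (t : F) : ∃ s : Matrix (Fin N) (Fin N) F, s.det = t ∧ s * M = M := by
  have hdet : M.det = 0 := by
    by_contra h0
    have := rank_of_det_ne_zero h0
    simp at this
    omega
  obtain ⟨y, hy, hyM⟩ := exists_vecMul_eq_zero_iff.2 hdet
  obtain ⟨i, hi⟩ := Function.ne_iff.1 hy
  refine ⟨1 + replicateCol Unit (Pi.single i ((t - 1) / y i)) * replicateRow Unit y, ?_, ?_⟩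
  · rw [det_one_add_replicateCol_mul_replicateRow]
    simp at hi
    simp [mul_div_cancel₀ _ hi]
  · have : replicateRow Unit y * M = 0 := by
      ext a b
      exact congrFun hyM b
    rw [Matrix.add_mul, Matrix.mul_assoc, this]
    simp

/-- A singular matrix absorbs the factors that normalise the determinants of P and Q. So below full
rank the special linear orbits are still classified by rank. -/
theorem Matrix.exists_specialLinearGroup_mul_mul_eq {M M' : Matrix (Fin N) (Fin N) F}
    (h : M.rank = M'.rank) (hM : M.rank < N) :
    ∃ g k : SpecialLinearGroup (Fin N) F,
      (g : Matrix (Fin N) (Fin N) F) * M * (k : Matrix (Fin N) (Fin N) F) = M' := by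
  obtain ⟨P, Q, hP, hQ, hPQ⟩ := exists_isUnit_mul_mul_eq_of_rank_eq h
  rw [isUnit_iff_isUnit_det, isUnit_iff_ne_zero] at hP hQ
  obtain ⟨s, hs, hsM⟩ := exists_det_eq_and_mul_eq_self hM P.det⁻¹
  obtain ⟨s', hs', hsM'⟩ := exists_det_eq_and_mul_eq_self (M := Mᵀ)
    (by rwa [rank_transpose]) Q.det⁻¹
  refine ⟨⟨P * s, by rw [det_mul, hs, mul_inv_cancel₀ hP]⟩,
    ⟨s'ᵀ * Q, by rw [det_mul, det_transpose, hs', inv_mul_cancel₀ hQ]⟩, ?_⟩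
  have h2 : M * s'ᵀ = M := by
    rw [← transpose_inj]
    simpa using hsM'
  calc P * s * M * (s'ᵀ * Q) = P * ((s * M) * s'ᵀ) * Q := by simp only [Matrix.mul_assoc]
    _ = M' := by rw [hsM, h2, hPQ]

/-- The diagonal matrix with `k` ones followed by zeros. -/
def Matrix.partialOne (F : Type*) [Field F] (N k : ℕ) : Matrix (Fin N) (Fin N) F :=
  diagonal fun i => if (i : ℕ) < k then 1 else 0

theorem Matrix.rank_partialOne {k : ℕ} (hk : k ≤ N) : (partialOne F N k).rank = k := by
  classical
  rw [partialOne, rank_diagonal]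
  simp only [ne_eq, ite_eq_right_iff, one_ne_zero, imp_false, not_not]
  rw [Fintype.card_subtype]
  have : (Finset.univ.filter fun i : Fin N => (i : ℕ) < k) =
      Finset.univ.map (Fin.castLEEmb hk) := by
    ext i
    simp only [Finset.mem_filter, Finset.mem_univ, true_and, Finset.mem_map]
    constructor
    · intro h
      exact ⟨⟨i, h⟩, rfl⟩
    · rintro ⟨a, rfl⟩
      simp
  rw [this]
  simp

/-- `partialOne F N k` factors through `F ^ k`. -/
theorem Matrix.exists_mul_eq_partialOne (F : Type*) [Field F] (N k : ℕ) :
    ∃ (B : Matrix (Fin N) (Fin k) F) (C : Matrix (Fin k) (Fin N) F),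
      B * C = partialOne F N k := by
  refine ⟨of fun i j => if (i : ℕ) = j then 1 else 0, of fun i j => if (i : ℕ) = j then 1 else 0, ?_⟩
  ext i j
  simp only [mul_apply, of_apply, partialOne, diagonal_apply, mul_ite, mul_one, mul_zero]
  by_cases hi : (i : ℕ) < k
  · rw [Finset.sum_eq_single ⟨i, hi⟩]
    · simp [hi, Fin.ext_iff]
    · intro b _ hb
      have : (i : ℕ) ≠ b := fun h => hb (Fin.ext h.symm)
      simp [this]
    · simp
  · rw [Finset.sum_eq_zero]
    · simp [hi]
    · intro b _
      have : (i : ℕ) ≠ b := by omega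
      simp [this]

variable [Fintype F]

/-- With A and D in normal form, the equation forces a block of size rank A × rank D in Z to vanish.
Filling that block arbitrarily gives disjoint translates of the solution set. -/
theorem Matrix.card_mul_mul_eq_zero_le (A D : Matrix (Fin N) (Fin N) F) :
    Nat.card {Z : Matrix (Fin N) (Fin N) F // A * Z * D = 0} * Fintype.card F ^ (A.rank * D.rank)
      ≤ Fintype.card F ^ (N * N) := by
  classical
  have hA : A.rank ≤ N := by simpa using A.rank_le_card_width
  have hD : D.rank ≤ N := by simpa using D.rank_le_card_width
  obtain ⟨P, Q, hP, hQ, hPQ⟩ := exists_isUnit_mul_mul_eq_of_rank_eq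
    (M := A) (M' := partialOne F N A.rank) (by rw [rank_partialOne hA])
  obtain ⟨P', Q', hP', hQ', hPQ'⟩ := exists_isUnit_mul_mul_eq_of_rank_eq
    (M := D) (M' := partialOne F N D.rank) (by rw [rank_partialOne hD])
  let E : (Fin A.rank → Fin D.rank → F) → Matrix (Fin N) (Fin N) F := fun w => of fun i j =>
    if h : (i : ℕ) < A.rank ∧ (j : ℕ) < D.rank then w ⟨i, h.1⟩ ⟨j, h.2⟩ else 0
  have hE : ∀ w w', partialOne F N A.rank * (E w - E w') * partialOne F N D.rank = 0 → w = w' := by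
    intro w w' h
    ext i j
    have hij := congrFun (congrFun h (Fin.castLE hA i)) (Fin.castLE hD j)
    simpa [partialOne, E, sub_eq_zero] using hij
  let f : {Z : Matrix (Fin N) (Fin N) F // A * Z * D = 0} × (Fin A.rank → Fin D.rank → F) →
      Matrix (Fin N) (Fin N) F := fun x => x.1.1 + Q * E x.2 * P'
  have hf : Function.Injective f := by
    rintro ⟨⟨Z, hZ⟩, w⟩ ⟨⟨Z', hZ'⟩, w'⟩ h
    have h0 : Z + Q * E w * P' = Z' + Q * E w' * P' := h
    have h1 : Q * (E w - E w') * P' = Z' - Z := by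
      rw [Matrix.mul_sub, Matrix.sub_mul, sub_eq_sub_iff_add_eq_add, add_comm, h0, add_comm]
    have hw : w = w' := by
      apply hE
      rw [← hPQ, ← hPQ']
      calc _ = P * (A * (Q * (E w - E w') * P') * D) * Q' := by simp only [Matrix.mul_assoc]
        _ = 0 := by rw [h1, Matrix.mul_sub, Matrix.sub_mul, hZ, hZ']; simp
    subst hw
    simpa using h0
  have := Nat.card_le_card_of_injective f hf
  rw [Nat.card_prod] at this
  have hM : Nat.card (Matrix (Fin N) (Fin N) F) = Fintype.card F ^ (N * N) := by
    simp [Matrix, pow_mul]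
  have hw : Nat.card (Fin A.rank → Fin D.rank → F) = Fintype.card F ^ (A.rank * D.rank) := by
    simp [pow_mul']
  rwa [hM, hw] at this

/-- The columns of B range independently over the kernel of D. -/
theorem Matrix.card_mul_eq_zero (D : Matrix (Fin N) (Fin N) F) (k : ℕ) :
    Nat.card {B : Matrix (Fin N) (Fin k) F // D * B = 0} * Fintype.card F ^ (k * D.rank)
      = Fintype.card F ^ (N * k) := by
  have e : {B : Matrix (Fin N) (Fin k) F // D * B = 0} ≃
      (Fin k → LinearMap.ker D.mulVecLin) :=
    { toFun := fun B j => ⟨fun i => B.1 i j, by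
        ext i
        exact congrFun (congrFun B.2 i) j⟩
      invFun := fun b => ⟨of fun i j => (b j).1 i, by
        ext i j
        exact congrFun (LinearMap.mem_ker.1 (b j).2) i⟩
      left_inv := fun B => rfl
      right_inv := fun b => rfl }
  have h2 := D.mulVecLin.finrank_range_add_finrank_ker
  rw [Nat.card_congr e, Nat.card_pi]
  simp only [Finset.prod_const, Finset.card_univ, Fintype.card_fin]
  rw [Module.natCard_eq_pow_finrank (K := F), Nat.card_eq_fintype_card, ← pow_mul, ← pow_add]
  congr 1
  rw [Module.finrank_fin_fun] at h2
  rw [Matrix.rank, mul_comm k, ← add_mul, add_comm, h2]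

end LinearAlgebra

/-! ### The size of the special linear group. -/

theorem one_quarter_le_prod_one_sub_pow {x : ℝ} (h0 : 0 ≤ x) (hx : x ≤ 1 / 2) (n : ℕ) :
    1 / 4 ≤ ∏ i ∈ Finset.range n, (1 - x ^ (i + 1)) := by
  -- The extra term makes the induction close: with t = (1/2)^(n+2) ≤ 1/4, (1/4 + t)(1 - t) ≥ 1/4 +
  -- t/2.
  have key : ∀ n : ℕ, 1 / 4 + (1 / 2 : ℝ) ^ (n + 2) ≤
      ∏ i ∈ Finset.range (n + 1), (1 - x ^ (i + 1)) := by
    intro n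
    induction n with
    | zero => norm_num; linarith
    | succ n ih =>
      rw [Finset.prod_range_succ]
      have h1 : x ^ (n + 1 + 1) ≤ (1 / 2) ^ (n + 2) := pow_le_pow_left₀ h0 hx _
      have h2 : (1 / 2 : ℝ) ^ (n + 2) ≤ 1 / 4 := by
        calc (1 / 2 : ℝ) ^ (n + 2) ≤ (1 / 2 : ℝ) ^ 2 :=
              pow_le_pow_of_le_one (by norm_num) (by norm_num) (by omega)
          _ = 1 / 4 := by norm_num
      have h3 : (0 : ℝ) < (1 / 2) ^ (n + 2) := by positivity
      calc 1 / 4 + (1 / 2 : ℝ) ^ (n + 1 + 2)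
          ≤ (1 / 4 + (1 / 2) ^ (n + 2)) * (1 - (1 / 2) ^ (n + 2)) := by
            rw [show n + 1 + 2 = (n + 2) + 1 by ring, pow_succ]
            nlinarith
        _ ≤ _ := mul_le_mul ih (by linarith) (by linarith) (by linarith)
  rcases n with _ | n
  · norm_num
  · exact le_trans (by simp) (key n)

/-- The general linear group has at least a quarter of all matrices, and a fixed rescaling for each
determinant embeds it in `SpecialLinearGroup × F`. -/
theorem Matrix.card_specialLinearGroup_ge {F : Type*} [Field F] [Fintype F] (N : ℕ) :
    (Fintype.card F : ℝ) ^ (N * N) ≤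
      4 * Fintype.card F * Nat.card (SpecialLinearGroup (Fin N) F) := by
  classical
  have hq : 2 ≤ Fintype.card F := Fintype.one_lt_card
  have hq' : (2 : ℝ) ≤ Fintype.card F := by exact_mod_cast hq
  set q : ℝ := (Fintype.card F : ℝ) with hqd
  have hGL : (Nat.card (GL (Fin N) F) : ℝ) =
      q ^ (N * N) * ∏ i ∈ Finset.range N, (1 - q⁻¹ ^ (i + 1)) := by
    rw [card_GL_field, Nat.cast_prod, pow_mul, ← Fin.prod_const N (q ^ N),
      ← Fin.prod_univ_eq_prod_range (fun i => 1 - q⁻¹ ^ (i + 1)) N,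
      ← Equiv.prod_comp Fin.revPerm (fun i : Fin N => 1 - q⁻¹ ^ ((i : ℕ) + 1)),
      ← Finset.prod_mul_distrib]
    refine Finset.prod_congr rfl fun i _ => ?_
    rw [Nat.cast_sub (Nat.pow_le_pow_right (by omega) i.2.le)]
    push_cast
    rw [← hqd, mul_sub, mul_one, inv_pow]
    congr 1
    rw [Fin.revPerm_apply, Fin.val_rev, eq_mul_inv_iff_mul_eq₀ (by positivity), ← pow_add]
    congr 1
    omega
  have hquot : Nat.card (GL (Fin N) F) ≤
      Nat.card (SpecialLinearGroup (Fin N) F) * Fintype.card F := by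
    rcases N with _ | N
    · simp
      exact Nat.one_le_iff_ne_zero.2 (by positivity)
    have hx : ∀ t : F, ∃ s : Matrix (Fin (N + 1)) (Fin (N + 1)) F, s.det = t := fun t => by
      obtain ⟨s, hs, -⟩ := exists_det_eq_and_mul_eq_self
        (M := (0 : Matrix (Fin (N + 1)) (Fin (N + 1)) F)) (by simp) t
      exact ⟨s, hs⟩
    choose s hs using hx
    let f : GL (Fin (N + 1)) F → SpecialLinearGroup (Fin (N + 1)) F × F := fun g =>
      (⟨s (g.1.det)⁻¹ * g.1, by
        rw [det_mul, hs, inv_mul_cancel₀]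
        exact ((isUnit_iff_isUnit_det _).1 g.isUnit).ne_zero⟩, g.1.det)
    have hf : Function.Injective f := by
      intro g g' h
      have h2 : g.1.det = g'.1.det := congrArg Prod.snd h
      have h1 : s (g.1.det)⁻¹ * g.1 = s (g'.1.det)⁻¹ * g'.1 :=
        congrArg (fun x => (Prod.fst x).1) h
      rw [h2] at h1
      have hu : IsUnit (s (g'.1.det)⁻¹) := by
        rw [isUnit_iff_isUnit_det, hs]
        exact ((isUnit_iff_isUnit_det _).1 g'.isUnit).inv
      exact Units.ext (hu.mul_left_cancel h1)
    simpa [Nat.card_prod] using Nat.card_le_card_of_injective f hf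
  have hquot' : (Nat.card (GL (Fin N) F) : ℝ) ≤ Nat.card (SpecialLinearGroup (Fin N) F) * q := by
    rw [hqd]
    exact_mod_cast hquot
  have h4 := one_quarter_le_prod_one_sub_pow (x := q⁻¹) (by positivity)
    (by rw [one_div]; exact inv_anti₀ (by norm_num) hq') N
  have h5 : 0 < q ^ (N * N) := by positivity
  nlinarith

/-! ### Fourier coefficients of orbit distributions. -/

section SphericalAverage

theorem card_matrix (F : Type*) [Fintype F] (m n : ℕ) :
    Fintype.card (Matrix (Fin m) (Fin n) F) = Fintype.card F ^ (m * n) := by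
  rw [← Nat.card_eq_fintype_card]
  simp [Matrix, pow_mul']

theorem rank_specialLinearGroup_mul_mul {F : Type*} [Field F] {N : ℕ}
    (g k : SpecialLinearGroup (Fin N) F)
    (A : Matrix (Fin N) (Fin N) F) : (g.1 * A * k.1).rank = A.rank := by
  rw [rank_mul_eq_left_of_isUnit_det _ _ (by rw [k.2]; exact isUnit_one),
    rank_mul_eq_right_of_isUnit_det _ _ (by rw [g.2]; exact isUnit_one)]

variable {F : Type*} [Field F] [Fintype F] [DecidableEq F] {χ : AddChar F ℂ}

/-- Orthogonality of characters: a nonzero entry of M makes the character nontrivial on a line of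
matrix units. -/
theorem AddChar.IsPrimitive.sum_trace_mul (hχ : χ.IsPrimitive) {m n : Type*} [Fintype m]
    [Fintype n] [DecidableEq m] [DecidableEq n] (M : Matrix n m F) :
    ∑ V : Matrix m n F, χ (trace (V * M)) =
      if M = 0 then (Fintype.card (Matrix m n F) : ℂ) else 0 := by
  let φ : Matrix m n F →+ F :=
    { toFun := fun V => trace (V * M)
      map_zero' := by simp
      map_add' := fun V W => by rw [Matrix.add_mul, trace_add] }
  have h := AddChar.sum_eq_ite (χ.compAddMonoidHom φ)
  have hiff : χ.compAddMonoidHom φ = 0 ↔ M = 0 := by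
    constructor
    · intro h0
      by_contra hM
      obtain ⟨i, j, hij⟩ : ∃ i j, M i j ≠ 0 := by
        by_contra! hc
        exact hM (by ext i j; simpa using hc i j)
      refine hχ hij (AddChar.ext _ _ fun a => ?_)
      have h1 := DFunLike.congr_fun h0 (Matrix.single j i a)
      simpa [φ, Matrix.trace_single_mul, mul_comm] using h1
    · rintro rfl
      ext V
      simp [φ]
  simp only [hiff] at h
  exact h

variable {N : ℕ}

/-- The average of `χ (tr (A U D V))` over all `U, V` in the special linear group: the Fourier
coefficient at `A` of the uniform distribution on the orbit of `D`. -/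
noncomputable def sphericalAverage (χ : AddChar F ℂ) (A D : Matrix (Fin N) (Fin N) F) : ℂ :=
  (∑ U : SpecialLinearGroup (Fin N) F, ∑ V : SpecialLinearGroup (Fin N) F,
    χ (trace (A * U.1 * D * V.1))) / (Nat.card (SpecialLinearGroup (Fin N) F) : ℂ) ^ 2

/-- Cyclicity of the trace lets g and k be absorbed by translating V and U. -/
theorem sphericalAverage_mul_mul (χ : AddChar F ℂ) (g k : SpecialLinearGroup (Fin N) F)
    (A D : Matrix (Fin N) (Fin N) F) :
    sphericalAverage χ (g.1 * A * k.1) D = sphericalAverage χ A D := by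
  unfold sphericalAverage
  refine congrArg (fun z : ℂ => z / (Nat.card (SpecialLinearGroup (Fin N) F) : ℂ) ^ 2) ?_
  conv_rhs => rw [← Equiv.sum_comp (Equiv.mulLeft k)]
  refine Finset.sum_congr rfl fun U _ => ?_
  conv_rhs => rw [← Equiv.sum_comp (Equiv.mulRight g)]
  refine Finset.sum_congr rfl fun V _ => ?_
  have h : g.1 * A * k.1 * U.1 * D * V.1 = g.1 * (A * (k.1 * U.1) * D * V.1) := by
    simp only [Matrix.mul_assoc]
  rw [h, trace_mul_comm]
  simp [Matrix.mul_assoc]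

theorem sphericalAverage_eq_of_rank_eq (χ : AddChar F ℂ) {A A' : Matrix (Fin N) (Fin N) F}
    (h : A.rank = A'.rank) (hA : A.rank < N) (D : Matrix (Fin N) (Fin N) F) :
    sphericalAverage χ A D = sphericalAverage χ A' D := by
  obtain ⟨g, k, rfl⟩ := exists_specialLinearGroup_mul_mul_eq h hA
  exact (sphericalAverage_mul_mul χ g k A D).symm

/-- For fixed U, V and B, the sum over C vanishes unless U D V B = 0, and the number of such B
depends only on the rank of D. -/
theorem sum_sphericalAverage_mul (hχ : χ.IsPrimitive) (k : ℕ)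
    (D : Matrix (Fin N) (Fin N) F) :
    ∑ x : Matrix (Fin N) (Fin k) F × Matrix (Fin k) (Fin N) F, sphericalAverage χ (x.1 * x.2) D
      = (Fintype.card F : ℂ) ^ (2 * (N * k)) * ((Fintype.card F : ℂ)⁻¹ ^ D.rank) ^ k := by
  have hq : (Fintype.card F : ℂ) ≠ 0 := Nat.cast_ne_zero.2 Fintype.card_ne_zero
  have hG : (Nat.card (SpecialLinearGroup (Fin N) F) : ℂ) ≠ 0 :=
    Nat.cast_ne_zero.2 Nat.card_pos.ne'
  have key : ∀ U V : SpecialLinearGroup (Fin N) F,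
      ∑ x : Matrix (Fin N) (Fin k) F × Matrix (Fin k) (Fin N) F,
        χ (trace (x.1 * x.2 * U.1 * D * V.1)) =
      (Fintype.card F : ℂ) ^ (2 * (N * k)) * ((Fintype.card F : ℂ)⁻¹ ^ D.rank) ^ k := by
    intro U V
    have h1 : ∀ (B : Matrix (Fin N) (Fin k) F), ∑ C : Matrix (Fin k) (Fin N) F,
        χ (trace (B * C * U.1 * D * V.1)) =
        if U.1 * D * V.1 * B = 0 then (Fintype.card F : ℂ) ^ (N * k) else 0 := by
      intro B
      have h2 : (Fintype.card (Matrix (Fin k) (Fin N) F) : ℂ) = (Fintype.card F : ℂ) ^ (N * k) := by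
        rw [card_matrix, mul_comm k]; push_cast; rfl
      rw [← h2, ← hχ.sum_trace_mul]
      refine Finset.sum_congr rfl fun C _ => ?_
      rw [show B * C * U.1 * D * V.1 = B * (C * (U.1 * D * V.1)) by simp only [Matrix.mul_assoc],
        trace_mul_comm, Matrix.mul_assoc]
    rw [Fintype.sum_prod_type]
    simp only [h1]
    rw [← Finset.sum_filter, Finset.sum_const, nsmul_eq_mul]
    have h3 := card_mul_eq_zero (U.1 * D * V.1) k
    rw [rank_specialLinearGroup_mul_mul, Nat.card_eq_fintype_card, Fintype.card_subtype] at h3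
    have h4 := congrArg (Nat.cast : ℕ → ℂ) h3
    push_cast at h4
    rw [← pow_mul, inv_pow, mul_comm D.rank k, two_mul, pow_add, ← h4]
    field_simp
  simp only [sphericalAverage]
  rw [← Finset.sum_div, Finset.sum_comm]
  rw [div_eq_iff (pow_ne_zero 2 hG)]
  calc _ = ∑ U : SpecialLinearGroup (Fin N) F, ∑ V : SpecialLinearGroup (Fin N) F,
        ∑ x : Matrix (Fin N) (Fin k) F × Matrix (Fin k) (Fin N) F,
          χ (trace (x.1 * x.2 * U.1 * D * V.1)) :=
        Finset.sum_congr rfl fun U _ => Finset.sum_comm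
    _ = _ := by
        simp only [key, Finset.sum_const, Finset.card_univ, nsmul_eq_mul, Nat.card_eq_fintype_card]
        ring

/-- At a frequency `A` of rank `k < N`, the Fourier coefficient of the uniform distribution on the
orbit of `D` is a polynomial of degree at most `k` in `|F| ^ (-rank D)`. -/
theorem exists_polynomial_sphericalAverage (hχ : χ.IsPrimitive) (k : ℕ) (hk : k < N) :
    ∃ p : Polynomial ℂ, p.natDegree ≤ k ∧ ∀ A D : Matrix (Fin N) (Fin N) F, A.rank = k →
      sphericalAverage χ A D = p.eval ((Fintype.card F : ℂ)⁻¹ ^ D.rank) := by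
  induction k using Nat.strong_induction_on with
  | _ k ih =>
    choose! P hP hPe using fun i (hi : i < k) => ih i hi (hi.trans hk)
    -- Products B C have rank at most k. Those of rank k share a single value of the average, which
    -- is solved for from the total; the others are polynomials of lower degree by induction.
    let s : Finset (Matrix (Fin N) (Fin k) F × Matrix (Fin k) (Fin N) F) :=
      Finset.univ.filter fun x => (x.1 * x.2).rank = k
    have hs : (s.card : ℂ) ≠ 0 := by
      obtain ⟨B, C, hBC⟩ := exists_mul_eq_partialOne F N k
      refine Nat.cast_ne_zero.2 (Finset.card_ne_zero_of_mem (a := (B, C)) ?_)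
      simp [s, hBC, rank_partialOne hk.le]
    have hlt : ∀ x ∈ sᶜ, (x.1 * x.2).rank < k := by
      intro x hx
      have h1 : (x.1 * x.2).rank ≠ k := by simpa [s] using hx
      have h2 : (x.1 * x.2).rank ≤ k :=
        (rank_mul_le_left _ _).trans (by simpa using x.1.rank_le_card_width)
      omega
    refine ⟨Polynomial.C (s.card : ℂ)⁻¹ * (Polynomial.C ((Fintype.card F : ℂ) ^ (2 * (N * k))) *
      Polynomial.X ^ k - ∑ x ∈ sᶜ, P (x.1 * x.2).rank), ?_, ?_⟩
    · refine (Polynomial.natDegree_C_mul_le _ _).trans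
        ((Polynomial.natDegree_sub_le _ _).trans (max_le ?_ ?_))
      · exact Polynomial.natDegree_C_mul_X_pow_le _ _
      · refine Polynomial.natDegree_sum_le_of_forall_le _ _ fun x hx => ?_
        exact (hP _ (hlt x hx)).trans (hlt x hx).le
    · intro A D hA
      have h := sum_sphericalAverage_mul hχ k D
      rw [← Finset.sum_add_sum_compl s] at h
      have h1 : ∑ x ∈ s, sphericalAverage χ (x.1 * x.2) D = s.card * sphericalAverage χ A D := by
        rw [← nsmul_eq_mul, ← Finset.sum_const]
        refine Finset.sum_congr rfl fun x hx => ?_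
        have hx' : (x.1 * x.2).rank = k := by simpa [s] using hx
        exact sphericalAverage_eq_of_rank_eq χ (hx'.trans hA.symm) (hx'.trans_lt hk) D
      have h2 : ∑ x ∈ sᶜ, sphericalAverage χ (x.1 * x.2) D =
          ∑ x ∈ sᶜ, (P (x.1 * x.2).rank).eval ((Fintype.card F : ℂ)⁻¹ ^ D.rank) :=
        Finset.sum_congr rfl fun x hx => hPe _ (hlt x hx) _ _ rfl
      rw [h1, h2] at h
      rw [Polynomial.eval_mul, Polynomial.eval_sub, Polynomial.eval_finsetSum]
      simp only [Polynomial.eval_C, Polynomial.eval_mul, Polynomial.eval_pow, Polynomial.eval_X]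
      rw [← h]
      field_simp
      ring

/-- Apply Cauchy–Schwarz over V, then let V range over all matrices: orthogonality leaves the pairs
U, U' with A(U - U')D = 0, which `card_mul_mul_eq_zero_le` bounds. The factor (4Q)² is the price of
the density of the special linear group. -/
theorem norm_sphericalAverage_sq_le (hχ : χ.IsPrimitive) (A D : Matrix (Fin N) (Fin N) F) :
    ‖sphericalAverage χ A D‖ ^ 2 ≤
      (4 * Fintype.card F) ^ 2 / (Fintype.card F : ℝ) ^ (A.rank * D.rank) := by
  set G := SpecialLinearGroup (Fin N) F
  set q : ℝ := (Fintype.card F : ℝ) with hq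
  have hq0 : 0 < q := by rw [hq]; exact_mod_cast Fintype.card_pos
  have hG : (0 : ℝ) < Nat.card G := by exact_mod_cast Nat.card_pos
  have hGq : q ^ (N * N) ≤ 4 * q * Nat.card G := card_specialLinearGroup_ge N
  let f : Matrix (Fin N) (Fin N) F → ℂ := fun V => ∑ U : G, χ (trace (A * U.1 * D * V))
  set z : ℝ := (Nat.card {Z : Matrix (Fin N) (Fin N) F // A * Z * D = 0} : ℝ) with hz
  have hzq : z * q ^ (A.rank * D.rank) ≤ q ^ (N * N) := by
    rw [hz, hq]; exact_mod_cast card_mul_mul_eq_zero_le A D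
  have h1 : ‖∑ U : G, ∑ V : G, χ (trace (A * U.1 * D * V.1))‖ ^ 2 ≤
      Nat.card G * ∑ V : G, ‖f V.1‖ ^ 2 := by
    rw [Finset.sum_comm]
    calc _ ≤ (∑ V : G, ‖f V.1‖) ^ 2 := pow_le_pow_left₀ (norm_nonneg _) (norm_sum_le _ _) 2
      _ ≤ _ := by
        rw [Nat.card_eq_fintype_card]
        exact sq_sum_le_card_mul_sum_sq
  have h2 : ∑ V : G, ‖f V.1‖ ^ 2 ≤ ∑ V : Matrix (Fin N) (Fin N) F, ‖f V‖ ^ 2 := by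
    have := Finset.sum_map Finset.univ
      ⟨fun V : G => V.1, Subtype.val_injective⟩ (fun V => ‖f V‖ ^ 2)
    rw [show ∑ V : G, ‖f V.1‖ ^ 2 = _ from this.symm]
    exact Finset.sum_le_univ_sum_of_nonneg fun V => by positivity
  have h3 : ((∑ V : Matrix (Fin N) (Fin N) F, ‖f V‖ ^ 2 : ℝ) : ℂ) =
      ∑ U' : G, ∑ U : G, if A * (U.1 - U'.1) * D = 0 then (q : ℂ) ^ (N * N) else 0 := by
    have hM : (Fintype.card (Matrix (Fin N) (Fin N) F) : ℂ) = (q : ℂ) ^ (N * N) := by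
      rw [card_matrix, hq]; push_cast; rfl
    simp only [← hM, ← hχ.sum_trace_mul]
    push_cast
    have h4 : ∀ V, ((‖f V‖ : ℂ)) ^ 2 =
        ∑ U' : G, ∑ U : G, χ (trace (V * (A * (U.1 - U'.1) * D))) := by
      intro V
      rw [← Complex.mul_conj', Finset.sum_comm]
      simp only [f, map_sum, Finset.sum_mul_sum]
      refine Finset.sum_congr rfl fun U _ => Finset.sum_congr rfl fun U' _ => ?_
      rw [← AddChar.map_neg_eq_conj, ← AddChar.map_add_eq_mul, trace_mul_comm V]
      congr 1
      rw [← sub_eq_add_neg, ← trace_sub]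
      simp only [Matrix.mul_sub, Matrix.sub_mul]
    simp only [h4]
    rw [Finset.sum_comm]
    exact Finset.sum_congr rfl fun U' _ => Finset.sum_comm
  have h5 : ∑ V : Matrix (Fin N) (Fin N) F, ‖f V‖ ^ 2 ≤ Nat.card G * (z * q ^ (N * N)) := by
    have h6 : ∑ V : Matrix (Fin N) (Fin N) F, ‖f V‖ ^ 2 =
        ∑ U' : G, ∑ U : G, if A * (U.1 - U'.1) * D = 0 then q ^ (N * N) else 0 := by
      apply Complex.ofReal_injective
      rw [h3]
      push_cast
      refine Finset.sum_congr rfl fun U' _ => Finset.sum_congr rfl fun U _ => ?_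
      split_ifs <;> simp
    rw [h6, Nat.card_eq_fintype_card, ← nsmul_eq_mul, ← Finset.card_univ]
    refine Finset.sum_le_card_nsmul _ _ _ fun U' _ => ?_
    rw [← Finset.sum_filter, Finset.sum_const, nsmul_eq_mul]
    gcongr
    rw [hz, Nat.card_eq_fintype_card, ← Fintype.card_subtype]
    norm_cast
    refine Fintype.card_le_of_injective
      (fun U : {U : G // A * (U.1 - U'.1) * D = 0} => ⟨U.1.1 - U'.1, U.2⟩) fun U W h => ?_
    have := congrArg Subtype.val h
    exact Subtype.ext (Subtype.ext (sub_left_injective this))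
  have hz0 : 0 ≤ z := Nat.cast_nonneg _
  have hqp : 0 < q ^ (N * N) := by positivity
  have hqr : 0 < q ^ (A.rank * D.rank) := by positivity
  unfold sphericalAverage
  rw [norm_div, div_pow, norm_pow, Complex.norm_natCast, div_le_div_iff₀ (by positivity) hqr]
  calc _ ≤ (Nat.card G * (Nat.card G * (z * q ^ (N * N)))) * q ^ (A.rank * D.rank) := by
        gcongr
        exact h1.trans (by gcongr; exact h2.trans h5)
    _ = (Nat.card G) ^ 2 * q ^ (N * N) * (z * q ^ (A.rank * D.rank)) := by ring
    _ ≤ (Nat.card G) ^ 2 * (4 * q * Nat.card G) * (4 * q * Nat.card G) := by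
        exact mul_le_mul (by gcongr) (hzq.trans hGq) (by positivity) (by positivity)
    _ = _ := by ring

end SphericalAverage

/-! ### Interpolation with small weights. -/

/-- Lagrange interpolation at the nodes `1, Q ^ t, …, Q ^ (t + K - 1)`, evaluated at a point of the
unit interval: the weights of all nodes but the first decay geometrically. -/
theorem exists_interpolation_weights {Q z : ℝ} (hQ : 2 ≤ Q) (hz0 : 0 ≤ z) (hz1 : z ≤ 1) {t : ℕ}
    (ht : 1 ≤ t) (K : ℕ) :
    ∃ (w₀ : ℝ) (w : ℕ → ℝ),
      (∀ i ≤ K, z ^ i = w₀ + ∑ s ∈ Finset.range K, w s * (Q ^ (t + s)) ^ i) ∧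
      ∀ s ∈ Finset.range K, |w s| ≤ 8 * Q⁻¹ ^ (t + s) := by
  have hQ0 : 0 < Q := by linarith
  have hQ1 : 1 < Q := by linarith
  let v : ℕ → ℝ := fun j => Nat.casesOn j 1 fun s => Q ^ (t + s)
  have hv0 : v 0 = 1 := rfl
  have hvs : ∀ s, v (s + 1) = Q ^ (t + s) := fun s => rfl
  have hmono : StrictMono v := by
    refine strictMono_nat_of_lt_succ fun n => ?_
    rcases n with _ | n
    · rw [hv0, hvs]
      exact one_lt_pow₀ hQ1 (by omega)
    · rw [hvs, hvs]
      exact pow_lt_pow_right₀ hQ1 (by omega)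
  have hinj : Set.InjOn v (Finset.range (K + 1)) := hmono.injective.injOn
  let b : ℕ → ℝ := fun j => (Lagrange.basis (Finset.range (K + 1)) v j).eval z
  refine ⟨b 0, fun s => b (s + 1), fun i hi => ?_, fun s hs => ?_⟩
  · have h := Lagrange.eq_interpolate_of_eval_eq (f := Polynomial.X ^ i) (fun j => v j ^ i) hinj
      (by
        rw [Polynomial.degree_X_pow, Finset.card_range]
        exact_mod_cast Nat.lt_succ_of_le hi) (by simp)
    have h2 := congrArg (Polynomial.eval z) h
    rw [Lagrange.interpolate_apply, Polynomial.eval_finsetSum, Finset.sum_range_succ'] at h2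
    simp only [Polynomial.eval_mul, Polynomial.eval_C, Polynomial.eval_pow, Polynomial.eval_X,
      hv0, one_pow, one_mul, hvs] at h2
    rw [h2, add_comm]
    simp only [b, mul_comm]
  · have hs' : s < K := Finset.mem_range.1 hs
    -- Bounds for the factors of the basis polynomial of node s + 1: the node 1 supplies the decay,
    -- smaller powers of Q cost at most 1, and larger ones a factor close to 1. The unused value at
    -- s + 1 itself is 1, so the erased index can be put back.
    let c : ℕ → ℝ := fun j => Nat.casesOn j (2 * Q⁻¹ ^ (t + s)) fun l =>
      if s < l then (1 - Q⁻¹ ^ (l - s))⁻¹ else 1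
    have hlt1 : ∀ j : ℕ, 0 < j → Q⁻¹ ^ j ≤ 1 / 2 := fun j hj => by
      calc Q⁻¹ ^ j ≤ Q⁻¹ ^ 1 := pow_le_pow_of_le_one (by positivity) (inv_le_one_of_one_le₀ hQ1.le) hj
        _ ≤ 1 / 2 := by
          rw [pow_one, one_div]
          exact inv_anti₀ (by norm_num) hQ
    have hc : ∀ j, j ≠ s + 1 → |(v (s + 1) - v j)⁻¹ * (z - v j)| ≤ c j := by
      intro j hj
      rw [abs_mul, abs_inv]
      rcases j with _ | l
      · rw [hv0, hvs]
        change _ ≤ 2 * Q⁻¹ ^ (t + s)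
        have h1 : 2 ≤ Q ^ (t + s) := hQ.trans (le_self_pow₀ hQ1.le (by omega))
        have h2 : |z - 1| ≤ 1 := by rw [abs_le]; constructor <;> linarith
        rw [abs_of_nonneg (by linarith : 0 ≤ Q ^ (t + s) - 1), inv_pow]
        calc (Q ^ (t + s) - 1)⁻¹ * |z - 1| ≤ (Q ^ (t + s) / 2)⁻¹ * 1 := by
              gcongr
              linarith
          _ = _ := by field_simp
      · have hz : |z - v (l + 1)| ≤ Q ^ (t + l) := by
          rw [hvs]
          have h1 : 1 ≤ Q ^ (t + l) := one_le_pow₀ hQ1.le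
          rw [abs_le]; constructor <;> linarith
        rw [hvs, hvs] at *
        have hls : l ≠ s := fun h => hj (by rw [h])
        change _ ≤ if s < l then (1 - Q⁻¹ ^ (l - s))⁻¹ else 1
        have hp : 0 < Q ^ (t + l) := by positivity
        split_ifs with hsl
        · have h1 : Q ^ (t + s) = Q ^ (t + l) * Q⁻¹ ^ (l - s) := by
            rw [inv_pow, eq_mul_inv_iff_mul_eq₀ (by positivity), ← pow_add]
            congr 1; omega
          have h2 := hlt1 (l - s) (by omega)
          have h3 : |Q ^ (t + s) - Q ^ (t + l)| = Q ^ (t + l) * (1 - Q⁻¹ ^ (l - s)) := by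
            rw [h1, abs_sub_comm, ← abs_of_nonneg (mul_nonneg hp.le
              (by linarith : 0 ≤ 1 - Q⁻¹ ^ (l - s)))]
            congr 1; ring
          rw [h3, mul_inv]
          have h4 : 0 < (1 - Q⁻¹ ^ (l - s))⁻¹ := inv_pos.2 (by linarith)
          calc _ ≤ (Q ^ (t + l))⁻¹ * (1 - Q⁻¹ ^ (l - s))⁻¹ * Q ^ (t + l) := by gcongr
            _ = _ := by field_simp
        · have h1 : Q * Q ^ (t + l) ≤ Q ^ (t + s) := by
            rw [← pow_succ']
            exact pow_le_pow_right₀ hQ1.le (by omega)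
          have h2 : Q ^ (t + l) ≤ |Q ^ (t + s) - Q ^ (t + l)| := by
            refine le_trans ?_ (le_abs_self _)
            nlinarith
          calc _ ≤ (Q ^ (t + l))⁻¹ * Q ^ (t + l) := by gcongr
            _ = 1 := by field_simp
    have hb : |b (s + 1)| ≤ ∏ j ∈ (Finset.range (K + 1)).erase (s + 1), c j := by
      simp only [b, Lagrange.basis, Polynomial.eval_prod, Lagrange.basisDivisor,
        Polynomial.eval_mul, Polynomial.eval_C, Polynomial.eval_sub, Polynomial.eval_X,
        Finset.abs_prod]
      exact Finset.prod_le_prod (fun _ _ => abs_nonneg _)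
        fun j hj => hc j (Finset.ne_of_mem_erase hj)
    have hcs : c (s + 1) = 1 := if_neg (lt_irrefl s)
    have hc1 : ∏ j ∈ (Finset.range (K + 1)).erase (s + 1), c j =
        ∏ j ∈ Finset.range (K + 1), c j := by
      rw [← Finset.mul_prod_erase (Finset.range (K + 1)) c (a := s + 1) (by simpa using hs'), hcs,
        one_mul]
    rw [hc1, Finset.prod_range_succ'] at hb
    refine hb.trans ?_
    change (∏ l ∈ Finset.range K, if s < l then (1 - Q⁻¹ ^ (l - s))⁻¹ else 1) *
      (2 * Q⁻¹ ^ (t + s)) ≤ _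
    -- Only the d nodes above s contribute factors exceeding 1; their product is at most 4, whence 8
    -- = 4 · 2.
    obtain ⟨d, rfl⟩ : ∃ d, K = s + 1 + d := ⟨K - (s + 1), by omega⟩
    rw [Finset.prod_range_add, Finset.prod_congr (g := fun _ => (1 : ℝ)) rfl
      (fun l hl => if_neg (by have := Finset.mem_range.1 hl; omega)), Finset.prod_const_one, one_mul]
    have h1 : (∏ l ∈ Finset.range d,
        if s < s + 1 + l then (1 - Q⁻¹ ^ (s + 1 + l - s))⁻¹ else 1) =
        (∏ l ∈ Finset.range d, (1 - Q⁻¹ ^ (l + 1)))⁻¹ := by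
      rw [← Finset.prod_inv_distrib]
      refine Finset.prod_congr rfl fun l _ => ?_
      rw [if_pos (by omega), show s + 1 + l - s = l + 1 by omega]
    rw [h1]
    have h2 := one_quarter_le_prod_one_sub_pow (x := Q⁻¹) (by positivity)
      (by simpa using hlt1 1 one_pos) d
    have h3 : (∏ l ∈ Finset.range d, (1 - Q⁻¹ ^ (l + 1)))⁻¹ ≤ 4 := by
      rw [show (4 : ℝ) = (1 / 4)⁻¹ by norm_num]
      exact inv_anti₀ (by norm_num) h2
    calc _ ≤ 4 * (2 * Q⁻¹ ^ (t + s)) := by gcongr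
      _ = _ := by ring

/-! ### Decision trees against small Fourier coefficients. -/

section DecisionTree

variable {F : Type*} [Field F] [Fintype F] [DecidableEq F] {χ : AddChar F ℂ}

/-- Restricting ψ to the inputs with a given answer multiplies it by an average of characters of
rank-one frequency. This only shifts B, so the bound η survives, and each query costs a factor |F|
for its branches. The query bound is asked only where ψ is nonzero, since a branch is controlled
only on inputs that reach it. -/
theorem BilinearAlg.norm_sum_run_le (hχ : χ.IsPrimitive) {n m : ℕ} {Ω : Type*} [Fintype Ω]
    (X : Ω → Matrix (Fin n) (Fin m) F) {η : ℝ} (t : BilinearAlg F n m) (q : ℕ) (ψ : Ω → ℂ)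
    (hψ : ∀ B : Matrix (Fin m) (Fin n) F, ‖∑ ω, ψ ω * χ (trace (B * X ω))‖ ≤ η)
    (hq : ∀ ω, ψ ω ≠ 0 → t.numQueries (X ω) ≤ q) :
    ‖∑ ω, ψ ω * (if t.run (X ω) = -1 then 1 else 0)‖ ≤ (Fintype.card F : ℝ) ^ q * η := by
  have hη : 0 ≤ η := (norm_nonneg _).trans (hψ 0)
  have hF0 : (0 : ℝ) < Fintype.card F := by exact_mod_cast Fintype.card_pos
  have hF : (1 : ℝ) ≤ Fintype.card F := by exact_mod_cast Fintype.card_pos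
  induction t generalizing q ψ with
  | output y =>
    have h1 : ‖∑ ω, ψ ω‖ ≤ η := by simpa using hψ 0
    have h2 : η ≤ (Fintype.card F : ℝ) ^ q * η := le_mul_of_one_le_left hη (one_le_pow₀ hF)
    simp only [run]
    by_cases hy : y = -1
    · simpa only [hy, if_true, mul_one] using h1.trans h2
    · simpa only [hy, if_false, mul_zero, Finset.sum_const_zero, norm_zero] using hη.trans h2
  | query u v next ih =>
    rcases q with _ | q
    · have h0 : ∀ ω, ψ ω = 0 := fun ω => by
        by_contra h
        simpa [numQueries] using hq ω h
      simpa [h0] using hη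
    let val : Ω → F := fun ω => u ⬝ᵥ (X ω *ᵥ v)
    let ψ' : F → Ω → ℂ := fun a ω => if val ω = a then ψ ω else 0
    have hval : ∀ ω, val ω = trace (vecMulVec v u * X ω) := fun ω => by
      rw [vecMulVec_mul, trace_vecMulVec, dotProduct_comm v, ← dotProduct_mulVec]
    have hstep : ∀ a, ‖∑ ω, ψ' a ω * (if (next a).run (X ω) = -1 then 1 else 0)‖ ≤
        (Fintype.card F : ℝ) ^ q * η := by
      intro a
      refine ih a q (ψ' a) (fun B => ?_) (fun ω hω => ?_)
      -- The indicator of the answer a, expanded in additive characters of F.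
      · have h1 : ∀ ω, ψ' a ω = (Fintype.card F : ℂ)⁻¹ * ∑ s : F, ψ ω * χ (s * (val ω - a)) := by
          intro ω
          rw [← Finset.mul_sum, AddChar.sum_mulShift _ hχ]
          simp only [ψ', sub_eq_zero]
          split_ifs
          · have : (Fintype.card F : ℂ) ≠ 0 := by exact_mod_cast hF0.ne'
            field_simp
          · simp
        have h2 : ∑ ω, ψ' a ω * χ (trace (B * X ω)) = (Fintype.card F : ℂ)⁻¹ *
            ∑ s : F, χ (-(s * a)) * ∑ ω, ψ ω * χ (trace ((B + s • vecMulVec v u) * X ω)) := by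
          simp only [h1, mul_assoc, ← Finset.mul_sum, Finset.sum_mul]
          congr 1
          simp only [Finset.mul_sum]
          rw [Finset.sum_comm]
          refine Finset.sum_congr rfl fun s _ => Finset.sum_congr rfl fun ω _ => ?_
          rw [Matrix.add_mul, trace_add, Matrix.smul_mul, trace_smul, ← hval,
            AddChar.map_add_eq_mul, mul_sub, sub_eq_add_neg, AddChar.map_add_eq_mul, smul_eq_mul]
          ring
        rw [h2, norm_mul, norm_inv, Complex.norm_natCast, inv_mul_le_iff₀ hF0]
        calc _ ≤ ∑ s : F, η := by
              refine norm_sum_le_of_le _ fun s _ => ?_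
              rw [norm_mul, AddChar.norm_apply, one_mul]
              exact hψ _
          _ = _ := by simp
      · have hω' : val ω = a ∧ ψ ω ≠ 0 := by
          simpa [ψ'] using hω
        have h3 := hq ω hω'.2
        simp only [numQueries] at h3
        rw [show u ⬝ᵥ (X ω *ᵥ v) = a from hω'.1] at h3
        omega
    have hsum : ∑ ω, ψ ω * (if (query u v next).run (X ω) = -1 then 1 else 0) =
        ∑ a, ∑ ω, ψ' a ω * (if (next a).run (X ω) = -1 then 1 else 0) := by
      rw [Finset.sum_comm]
      refine Finset.sum_congr rfl fun ω _ => ?_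
      simp only [ψ', ite_mul, zero_mul, Finset.sum_ite_eq, Finset.mem_univ, if_true]
      rfl
    rw [hsum]
    calc _ ≤ ∑ a : F, (Fintype.card F : ℝ) ^ q * η := norm_sum_le_of_le _ fun a _ => hstep a
      _ = _ := by simp; ring

end DecisionTree

/-! ### The advantage of a deterministic algorithm on two orbits. -/

section Advantage

theorem BilinearAlg.exists_eq_output {F : Type*} [Field F] {n m : ℕ} (t : BilinearAlg F n m)
    (ht : ∀ X, t.numQueries X ≤ 0) : ∃ y, t = .output y := by
  cases t with
  | output y => exact ⟨y, rfl⟩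
  | query u v next => simpa [numQueries] using ht 0

variable {F : Type*} [Field F] [Fintype F] [DecidableEq F]

theorem exists_addChar_isPrimitive (F : Type*) [Field F] [Finite F] :
    ∃ χ : AddChar F ℂ, χ.IsPrimitive := by
  obtain ⟨χ, hχ⟩ := AddChar.exists_apply_ne_zero.2 (one_ne_zero (α := F))
  exact ⟨χ, AddChar.IsPrimitive.of_ne_one (AddChar.ne_one_iff.2 ⟨1, hχ⟩)⟩

/-- The probability that the output is `-1` on the input `P U D V P'`, for `U` and `V` uniformly
distributed on the special linear group. -/
noncomputable def orbitProb {N n m : ℕ} (t : BilinearAlg F n m) (P : Matrix (Fin n) (Fin N) F)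
    (P' : Matrix (Fin N) (Fin m) F) (D : Matrix (Fin N) (Fin N) F) : ℝ :=
  (∑ U : SpecialLinearGroup (Fin N) F, ∑ V : SpecialLinearGroup (Fin N) F,
    if t.run (P * (U.1 * D * V.1) * P') = -1 then 1 else 0) /
      (Nat.card (SpecialLinearGroup (Fin N) F) : ℝ) ^ 2

theorem orbitProb_nonneg {N n m : ℕ} (t : BilinearAlg F n m) (P : Matrix (Fin n) (Fin N) F)
    (P' : Matrix (Fin N) (Fin m) F) (D : Matrix (Fin N) (Fin N) F) : 0 ≤ orbitProb t P P' D :=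
  div_nonneg (Finset.sum_nonneg fun _ _ => Finset.sum_nonneg fun _ _ => by positivity)
    (by positivity)

theorem orbitProb_le_one {N n m : ℕ} (t : BilinearAlg F n m) (P : Matrix (Fin n) (Fin N) F)
    (P' : Matrix (Fin N) (Fin m) F) (D : Matrix (Fin N) (Fin N) F) : orbitProb t P P' D ≤ 1 := by
  refine div_le_one_of_le₀ ?_ (by positivity)
  calc _ ≤ ∑ U : SpecialLinearGroup (Fin N) F, ∑ V : SpecialLinearGroup (Fin N) F, (1 : ℝ) :=
        Finset.sum_le_sum fun _ _ => Finset.sum_le_sum fun _ _ => by split_ifs <;> norm_num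
    _ = _ := by simp [Nat.card_eq_fintype_card, sq]

theorem orbitProb_output {N n m : ℕ} (y : ℤˣ) (P : Matrix (Fin n) (Fin N) F)
    (P' : Matrix (Fin N) (Fin m) F) (D D' : Matrix (Fin N) (Fin N) F) :
    orbitProb (.output y) P P' D = orbitProb (.output y) P P' D' := by
  unfold orbitProb
  refine congrArg (fun z : ℝ => z / (Nat.card (SpecialLinearGroup (Fin N) F) : ℝ) ^ 2) ?_
  exact Finset.sum_congr rfl fun U _ => Finset.sum_congr rfl fun V _ => rfl

/-- If a linear combination of orbit distributions has small Fourier coefficients, then no algorithm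
with few queries correlates with it. -/
theorem abs_sum_orbitProb_le {χ : AddChar F ℂ} (hχ : χ.IsPrimitive) {N n m q : ℕ}
    (t : BilinearAlg F n m) (ht : ∀ X, t.numQueries X ≤ q) (P : Matrix (Fin n) (Fin N) F)
    (P' : Matrix (Fin N) (Fin m) F) {ι : Type*} [Fintype ι] (a : ι → ℝ)
    (D : ι → Matrix (Fin N) (Fin N) F) {η : ℝ}
    (hη : ∀ A, ‖∑ i, (a i : ℂ) * sphericalAverage χ A (D i)‖ ≤ η) :
    |∑ i, a i * orbitProb t P P' (D i)| ≤ (Fintype.card F : ℝ) ^ q * η := by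
  let G := SpecialLinearGroup (Fin N) F
  let X : ι × G × G → Matrix (Fin n) (Fin m) F := fun ω => P * (ω.2.1.1 * D ω.1 * ω.2.2.1) * P'
  let ψ : ι × G × G → ℂ := fun ω => a ω.1 / (Nat.card G : ℂ) ^ 2
  have h := t.norm_sum_run_le hχ X q ψ (η := η) (fun B => ?_) fun ω _ => ht _
  · rw [← Real.norm_eq_abs, ← Complex.norm_real]
    convert h using 2
    rw [Fintype.sum_prod_type]
    push_cast
    refine Finset.sum_congr rfl fun i _ => ?_
    rw [Fintype.sum_prod_type, orbitProb]
    push_cast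
    simp only [ψ, X, Finset.sum_div, Finset.mul_sum]
    refine Finset.sum_congr rfl fun U _ => Finset.sum_congr rfl fun V _ => ?_
    split_ifs <;> simp [G, div_eq_mul_inv]
  -- A frequency B on n × m matrices pulls back to P' B P on N × N matrices.
  · convert hη (P' * B * P) using 2
    rw [Fintype.sum_prod_type]
    refine Finset.sum_congr rfl fun i _ => ?_
    rw [Fintype.sum_prod_type, sphericalAverage]
    simp only [ψ, X, Finset.sum_div, Finset.mul_sum]
    refine Finset.sum_congr rfl fun U _ => Finset.sum_congr rfl fun V _ => ?_
    have h1 : trace (B * (P * (U.1 * D i * V.1) * P')) =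
        trace (P' * B * P * U.1 * D i * V.1) := by
      rw [← Matrix.mul_assoc, trace_mul_comm]
      simp only [Matrix.mul_assoc]
    rw [h1]
    simp only [G]
    ring

theorem norm_sphericalAverage_le {χ : AddChar F ℂ} (hχ : χ.IsPrimitive) {N L : ℕ}
    (A D : Matrix (Fin N) (Fin N) F) (hL : 2 * L ≤ A.rank * D.rank) :
    ‖sphericalAverage χ A D‖ ≤ 4 * Fintype.card F / (Fintype.card F : ℝ) ^ L := by
  have hq : (1 : ℝ) ≤ Fintype.card F := by exact_mod_cast Fintype.card_pos
  refine (pow_le_pow_iff_left₀ (norm_nonneg _) (by positivity) two_ne_zero).1 ?_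
  refine (norm_sphericalAverage_sq_le hχ A D).trans ?_
  rw [div_pow, ← pow_mul, mul_comm L]
  gcongr

/-- Fourier coefficients at low-rank frequencies of a combination whose weights annihilate all
polynomials of low degree. -/
theorem sum_mul_sphericalAverage_eq_zero {χ : AddChar F ℂ} (hχ : χ.IsPrimitive) {N K : ℕ}
    {ι : Type*} [Fintype ι] (a : ι → ℝ) (D : ι → Matrix (Fin N) (Fin N) F)
    (ha : ∀ e ≤ K, ∑ i, a i * ((Fintype.card F : ℝ)⁻¹ ^ (D i).rank) ^ e = 0)
    (A : Matrix (Fin N) (Fin N) F) (hA : A.rank ≤ K) (hN : A.rank < N) :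
    ∑ i, (a i : ℂ) * sphericalAverage χ A (D i) = 0 := by
  obtain ⟨p, hp, hpe⟩ := exists_polynomial_sphericalAverage hχ A.rank hN
  simp only [hpe A _ rfl, Polynomial.eval_eq_sum_range, Finset.mul_sum]
  rw [Finset.sum_comm]
  refine Finset.sum_eq_zero fun e he => ?_
  have h1 := congrArg (Complex.ofReal) (ha e (by have := Finset.mem_range.1 he; omega))
  push_cast at h1
  calc _ = p.coeff e * ∑ i, (a i : ℂ) * ((Fintype.card F : ℂ)⁻¹ ^ (D i).rank) ^ e := by
        rw [Finset.mul_sum]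
        exact Finset.sum_congr rfl fun i _ => by ring
    _ = 0 := by rw [h1, mul_zero]

theorem abs_orbitProb_sub_orbitProb_le {N n m r q : ℕ} (hr : r < N)
    (t : BilinearAlg F n m) (hq : 3600 * q ≤ r ^ 2) (ht : ∀ X, t.numQueries X ≤ q)
    (P : Matrix (Fin n) (Fin N) F) (P' : Matrix (Fin N) (Fin m) F)
    {E : Matrix (Fin N) (Fin N) F} (hE : E.rank = N) :
    |orbitProb t P P' E - orbitProb t P P' (partialOne F N r)| ≤
      3 / 16 * (1 / (Fintype.card F : ℝ) ^ ((r : ℝ) / 3)) := by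
  set Q : ℝ := (Fintype.card F : ℝ) with hQd
  have hQ : 2 ≤ Q := by
    rw [hQd]; exact_mod_cast (Fintype.one_lt_card : 1 < Fintype.card F)
  have hQ0 : 0 < Q := by linarith
  set δ : ℝ := 1 / Q ^ ((r : ℝ) / 3) with hδ
  have hδ0 : 0 < δ := by positivity
  -- Without queries the output is constant; with at least one, 3600 q ≤ r² forces r ≥ 60, which
  -- absorbs all rounding below.
  rcases Nat.eq_zero_or_pos q with rfl | hq0
  · obtain ⟨y, rfl⟩ := t.exists_eq_output ht
    have : orbitProb (.output y) P P' E = orbitProb (.output y) P P' (partialOne F N r) :=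
      orbitProb_output y P P' _ _
    rw [this, sub_self, abs_zero]
    positivity
  have hr60 : 60 ≤ r := by nlinarith
  obtain ⟨χ, hχ⟩ := exists_addChar_isPrimitive F
  set K := r / 6 with hK
  -- One unit covers the rounding of r/3, and the other eight give the factor 2^8 = 256.
  set τ := r / 3 + 9 with hτ
  have hT : Q⁻¹ ^ τ ≤ δ / 256 := by
    have h1 : Q ^ ((r : ℝ) / 3) * 256 ≤ Q ^ τ := by
      have h2 : (r : ℝ) / 3 ≤ (r / 3 : ℕ) + 1 := by
        have : r ≤ 3 * (r / 3 + 1) := by omega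
        have : (r : ℝ) ≤ 3 * ((r / 3 : ℕ) + 1) := by exact_mod_cast this
        linarith
      have h3 : (256 : ℝ) ≤ Q ^ 8 := by
        calc (256 : ℝ) = 2 ^ 8 := by norm_num
          _ ≤ Q ^ 8 := pow_le_pow_left₀ (by norm_num) hQ 8
      calc Q ^ ((r : ℝ) / 3) * 256 ≤ Q ^ (((r / 3 + 1 : ℕ) : ℝ)) * Q ^ 8 := by
            gcongr
            · linarith
            · push_cast; exact h2
        _ = Q ^ τ := by rw [Real.rpow_natCast, ← pow_add]
    rw [inv_pow, hδ, div_div, one_div]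
    exact inv_anti₀ (by positivity) h1
  have hδ1 : δ ≤ 1 := by
    rw [hδ, div_le_one (by positivity)]
    exact Real.one_le_rpow (by linarith) (by positivity)
  -- In units of Q^(-r), the point z stands for rank N, the node 1 for rank r, and the node Q^(τ+s)
  -- for rank r - τ - s.
  obtain ⟨w₀, w, hw, hwb⟩ := exists_interpolation_weights hQ (z := Q⁻¹ ^ (N - r)) (by positivity)
    (pow_le_one₀ (by positivity) (inv_le_one_of_one_le₀ (by linarith))) (t := τ) (by omega) K
  let W : ℝ := ∑ s : Fin K, |w s|
  have hW : W ≤ 16 * Q⁻¹ ^ τ := by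
    have h1 : ∑ s ∈ Finset.range K, Q⁻¹ ^ s ≤ 2 := by
      have hlt : Q⁻¹ ≤ 1 / 2 := by rw [one_div]; exact inv_anti₀ (by norm_num) hQ
      have hQi : 0 < Q⁻¹ := by positivity
      have h2 := geom_sum_mul_neg Q⁻¹ K
      have h3 : 0 ≤ ∑ s ∈ Finset.range K, Q⁻¹ ^ s := by positivity
      have h4 : 0 < Q⁻¹ ^ K := by positivity
      nlinarith
    calc W = ∑ s ∈ Finset.range K, |w s| := Fin.sum_univ_eq_sum_range (fun s => |w s|) K
      _ ≤ ∑ s ∈ Finset.range K, 8 * Q⁻¹ ^ (τ + s) := Finset.sum_le_sum hwb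
      _ = 8 * Q⁻¹ ^ τ * ∑ s ∈ Finset.range K, Q⁻¹ ^ s := by
        rw [Finset.mul_sum]
        exact Finset.sum_congr rfl fun s _ => by rw [pow_add]; ring
      _ ≤ 8 * Q⁻¹ ^ τ * 2 := by gcongr
      _ = _ := by ring
  have hw0 : |w₀ - 1| ≤ W := by
    have h1 := hw 0 (Nat.zero_le _)
    simp only [pow_zero, mul_one] at h1
    rw [h1, ← Fin.sum_univ_eq_sum_range (fun s => w s) K, sub_add_cancel_left, abs_neg]
    exact Finset.abs_sum_le_sum_abs _ _
  let ι := Option (Option (Fin K))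
  let a : ι → ℝ := fun i => i.elim 1 fun i => i.elim (-w₀) fun s => -w s
  let D : ι → Matrix (Fin N) (Fin N) F := fun i =>
    i.elim E fun i => i.elim (partialOne F N r) fun s => partialOne F N (r - τ - s)
  have hrank1 : (partialOne F N r).rank = r := rank_partialOne hr.le
  have hrank2 : ∀ s : ℕ, (partialOne F N (r - τ - s)).rank = r - τ - s :=
    fun s => rank_partialOne (by omega)
  have ha : ∀ e ≤ K, ∑ i, a i * (Q⁻¹ ^ (D i).rank) ^ e = 0 := by
    intro e he
    rw [Fintype.sum_option, Fintype.sum_option]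
    simp only [a, D, Option.elim, hE, hrank1, hrank2]
    have h1 : Q⁻¹ ^ N = Q⁻¹ ^ r * Q⁻¹ ^ (N - r) := by
      rw [← pow_add]; congr 1; omega
    have h2 : ∀ s : Fin K, Q⁻¹ ^ (r - τ - s) = Q⁻¹ ^ r * Q ^ (τ + s) := by
      intro s
      rw [inv_pow, inv_pow, eq_inv_mul_iff_mul_eq₀ (by positivity), mul_inv_eq_iff_eq_mul₀
        (by positivity), ← pow_add]
      congr 1
      have := s.2
      omega
    simp only [h2, h1, mul_pow _ _ e]
    rw [hw e he, ← Fin.sum_univ_eq_sum_range (fun s => w s * (Q ^ (τ + s)) ^ e) K, mul_add,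
      Finset.mul_sum, one_mul]
    rw [show ∀ x y z u : ℝ, x * y + z + (-y * x + u) = z + u by intros; ring,
      ← Finset.sum_add_distrib]
    exact Finset.sum_eq_zero fun s _ => by ring
  have hsuma : ∑ i, |a i| ≤ 4 := by
    rw [Fintype.sum_option, Fintype.sum_option]
    simp only [a, Option.elim, abs_one, abs_neg]
    have h1 : |w₀| ≤ 1 + W := by
      have := abs_add_le (w₀ - 1) 1
      rw [sub_add_cancel, abs_one] at this
      linarith
    change 1 + (|w₀| + W) ≤ 4
    linarith
  -- L = q + τ + 1, so that Q^q · 16Q / Q^L = 16 Q^(-τ).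
  set L := q + (r / 3 + 10) with hL
  have hη : ∀ A, ‖∑ i, (a i : ℂ) * sphericalAverage χ A (D i)‖ ≤ 4 * (4 * Q / Q ^ L) := by
    intro A
    rcases le_or_gt A.rank K with hA | hA
    · rw [sum_mul_sphericalAverage_eq_zero hχ a D ha A hA (by omega), norm_zero]
      positivity
    · calc _ ≤ ∑ i, |a i| * (4 * Q / Q ^ L) := by
            refine norm_sum_le_of_le _ fun i _ => ?_
            rw [norm_mul, Complex.norm_real, Real.norm_eq_abs]
            refine mul_le_mul_of_nonneg_left ?_ (abs_nonneg _)
            refine norm_sphericalAverage_le hχ A (D i) ?_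
            have hD : r - τ - (K - 1) ≤ (D i).rank := by
              rcases i with _ | _ | s
              · change _ ≤ E.rank
                omega
              · change _ ≤ (partialOne F N r).rank
                omega
              · change _ ≤ (partialOne F N (r - τ - s)).rank
                rw [hrank2]
                have := s.2
                omega
            -- The first factor is at least r/6 and the second at least r/3, so the product is at
            -- least r²/18; this dominates 2L because q ≤ r²/3600 and r ≥ 60.
            have h1 : (r / 6 + 1) * (r - τ - (K - 1)) ≤ A.rank * (D i).rank :=
              Nat.mul_le_mul hA hD
            refine le_trans ?_ h1
            have h2 : r ≤ 6 * (r / 6 + 1) := by omega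
            have h3 : r ≤ 3 * (r - τ - (K - 1)) := by omega
            have h4 : r * r ≤ 6 * (r / 6 + 1) * (3 * (r - τ - (K - 1))) := Nat.mul_le_mul h2 h3
            have h5 : 3 * (r / 3) ≤ r := by omega
            nlinarith
        _ = (∑ i, |a i|) * (4 * Q / Q ^ L) := by rw [Finset.sum_mul]
        _ ≤ _ := by gcongr
  have hmain := abs_sum_orbitProb_le hχ t ht P P' a D hη
  have hQη : Q ^ q * (4 * (4 * Q / Q ^ L)) = 16 * Q⁻¹ ^ τ := by
    rw [show L = q + τ + 1 by omega, inv_pow, pow_add, pow_add]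
    field_simp
    norm_num
  rw [hQη, Fintype.sum_option, Fintype.sum_option] at hmain
  simp only [a, D, Option.elim, one_mul] at hmain
  set pE := orbitProb t P P' E
  set pr := orbitProb t P P' (partialOne F N r)
  set S := ∑ s : Fin K, w s * orbitProb t P P' (partialOne F N (r - τ - s)) with hS
  have hSW : |S| ≤ W := by
    refine (Finset.abs_sum_le_sum_abs _ _).trans (Finset.sum_le_sum fun s _ => ?_)
    rw [abs_mul, abs_of_nonneg (orbitProb_nonneg _ _ _ _)]
    exact mul_le_of_le_one_right (abs_nonneg _) (orbitProb_le_one _ _ _ _)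
  have hpr : |(w₀ - 1) * pr| ≤ W := by
    rw [abs_mul, abs_of_nonneg (orbitProb_nonneg _ _ _ _)]
    exact (mul_le_of_le_one_right (abs_nonneg _) (orbitProb_le_one _ _ _ _)).trans hw0
  have hneg : ∑ s : Fin K, -w s * orbitProb t P P' (partialOne F N (r - τ - s)) = -S := by
    rw [hS, ← Finset.sum_neg_distrib]
    exact Finset.sum_congr rfl fun s _ => by ring
  rw [hneg] at hmain
  rw [abs_le] at hmain hSW hpr ⊢
  -- Three errors of at most 16 Q^(-τ) ≤ δ/16 each: the Fourier bound, w₀ ≠ 1, and the lower-rank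
  -- terms.
  constructor <;> linarith [hmain.1, hmain.2, hSW.1, hSW.2, hpr.1, hpr.2]

end Advantage

/-! ### From deterministic advantage to randomized query complexity. -/

section QueryComplexity

theorem PMF.hasSum_toReal_mul_ite {α : Type*} (p : PMF α) (s : α → Prop) [DecidablePred s] :
    HasSum (fun t => (p t).toReal * if s t then 1 else 0)
      (p.toOuterMeasure {t | s t}).toReal := by
  have hne : ∀ t, Set.indicator {t | s t} p t ≠ ⊤ := fun t => by
    by_cases h : t ∈ {t | s t}
    · rw [Set.indicator_of_mem h]
      exact p.apply_ne_top t
    · rw [Set.indicator_of_notMem h]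
      exact ENNReal.zero_ne_top
  have htop : ∑' t, Set.indicator {t | s t} p t ≠ ⊤ :=
    ne_top_of_le_ne_top p.tsum_coe_ne_top
      (ENNReal.tsum_le_tsum fun t => Set.indicator_le_self _ _ t)
  rw [PMF.toOuterMeasure_apply, ENNReal.tsum_toReal_eq hne]
  convert (ENNReal.summable_toReal htop).hasSum using 2 with t
  by_cases h : s t <;> simp [h]

theorem PMF.hasSum_toReal {α : Type*} (p : PMF α) : HasSum (fun t => (p t).toReal) 1 := by
  have h := (ENNReal.summable_toReal p.tsum_coe_ne_top).hasSum
  rwa [← ENNReal.tsum_toReal_eq p.apply_ne_top, p.tsum_coe, ENNReal.toReal_one] at h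

theorem det_specialLinearGroup_mul_mul {F : Type*} [Field F] {N : ℕ}
    (U V : SpecialLinearGroup (Fin N) F)
    (M : Matrix (Fin N) (Fin N) F) : (U.1 * M * V.1).det = M.det := by
  rw [det_mul, det_mul, U.2, V.2, one_mul, mul_one]

theorem Matrix.exists_det_eq {F : Type*} [Field F] {N : ℕ} (hN : 0 < N) (a : F) :
    ∃ E : Matrix (Fin N) (Fin N) F, E.det = a := by
  obtain ⟨s, hs, -⟩ := exists_det_eq_and_mul_eq_self
    (M := (0 : Matrix (Fin N) (Fin N) F)) (by simpa using hN) a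
  exact ⟨s, hs⟩

variable {F : Type*} [Field F] [Fintype F] [DecidableEq F]

/-- If the orbit distributions of `D₁` and `D₂` are supported on `f = -1` and `f = 1` and no
deterministic algorithm with `q` queries distinguishes them well, then `f` needs more than `q`
queries. -/
theorem lt_BLQ {N n m q : ℕ} {f : PartialMatrixFun F n m} {ε β : ℝ} (hε : 0 ≤ ε)
    (P : Matrix (Fin n) (Fin N) F) (P' : Matrix (Fin N) (Fin m) F)
    (D₁ D₂ : Matrix (Fin N) (Fin N) F)
    (h₁ : ∀ U V : SpecialLinearGroup (Fin N) F, f (P * (U.1 * D₁ * V.1) * P') = some (-1))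
    (h₂ : ∀ U V : SpecialLinearGroup (Fin N) F, f (P * (U.1 * D₂ * V.1) * P') = some 1)
    (hβ : ∀ t : BilinearAlg F n m, (∀ X, t.numQueries X ≤ q) →
      |orbitProb t P P' D₁ - orbitProb t P P' D₂| ≤ β)
    (hεβ : β < 1 - 2 * ε) : q < BLQ ε f := by
  by_contra hlt
  rw [not_lt] at hlt
  obtain ⟨p, hcost, hcomp⟩ := Nat.sInf_mem
    (s := {c : ℕ | ∃ p : PMF (BilinearAlg F n m), CostAtMost p c ∧ ComputesWithError p f ε})
    ⟨n * m, exists_randomized_bilinearAlg hε f⟩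
  have hcost' : ∀ t ∈ p.support, ∀ X, t.numQueries X ≤ q := fun t ht X => (hcost t ht X).trans hlt
  let G := SpecialLinearGroup (Fin N) F
  have hG : (0 : ℝ) < Nat.card G := by exact_mod_cast Nat.card_pos
  let e : Matrix (Fin n) (Fin m) F → ℝ := fun X => (p.toOuterMeasure {t | t.run X = -1}).toReal
  have he : ∀ X, HasSum (fun t => (p t).toReal * if t.run X = -1 then 1 else 0) (e X) :=
    fun X => p.hasSum_toReal_mul_ite _
  have he₁ : ∀ X, f X = some (-1) → 1 - ε ≤ e X := by
    intro X hX
    have h1 := p.hasSum_toReal_mul_ite (fun t => t.run X ≠ -1)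
    have h2 := p.hasSum_toReal.sub (he X)
    have h3 : (p.toOuterMeasure {t | t.run X ≠ -1}).toReal = 1 - e X := by
      refine h1.unique ?_
      have h4 : (fun t : BilinearAlg F n m => (p t).toReal * if t.run X ≠ -1 then (1 : ℝ) else 0) =
          fun t => (p t).toReal - (p t).toReal * if t.run X = -1 then 1 else 0 := by
        funext t
        by_cases h : t.run X = -1 <;> simp [h]
      rw [h4]
      exact h2
    have := hcomp X (-1) hX
    linarith
  have he₂ : ∀ X, f X = some 1 → e X ≤ ε := by
    intro X hX
    have h1 := hcomp X 1 hX
    have h2 : {t : BilinearAlg F n m | t.run X ≠ 1} = {t | t.run X = -1} := by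
      ext t
      rcases Int.units_eq_one_or (t.run X) with h | h <;> simp [h]
    rwa [h2] at h1
  let avg : Matrix (Fin N) (Fin N) F → ℝ := fun D =>
    (∑ U : G, ∑ V : G, e (P * (U.1 * D * V.1) * P')) / (Nat.card G : ℝ) ^ 2
  have havg : ∀ D, HasSum (fun t => (p t).toReal * orbitProb t P P' D) (avg D) := by
    intro D
    have h1 := (hasSum_sum fun (U : G) (_ : U ∈ Finset.univ) =>
      hasSum_sum fun (V : G) (_ : V ∈ Finset.univ) =>
        he (P * (U.1 * D * V.1) * P')).div_const ((Nat.card G : ℝ) ^ 2)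
    have h2 : (fun t => (p t).toReal * orbitProb t P P' D) = fun t =>
        (∑ U : G, ∑ V : G, (p t).toReal *
          if t.run (P * (U.1 * D * V.1) * P') = -1 then 1 else 0) / (Nat.card G : ℝ) ^ 2 := by
      funext t
      rw [orbitProb, ← mul_div_assoc]
      simp only [Finset.mul_sum, G]
    rw [h2]
    exact h1
  have hconst : ∀ x : ℝ, (∑ _U : G, ∑ _V : G, x) / (Nat.card G : ℝ) ^ 2 = x := by
    intro x
    simp only [Finset.sum_const, Finset.card_univ, nsmul_eq_mul, Nat.card_eq_fintype_card] at hG ⊢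
    field_simp
  have havg₁ : 1 - ε ≤ avg D₁ := by
    rw [← hconst (1 - ε)]
    exact div_le_div_of_nonneg_right (Finset.sum_le_sum fun U _ => Finset.sum_le_sum fun V _ =>
      he₁ _ (h₁ U V)) (by positivity)
  have havg₂ : avg D₂ ≤ ε := by
    rw [← hconst ε]
    exact div_le_div_of_nonneg_right (Finset.sum_le_sum fun U _ => Finset.sum_le_sum fun V _ =>
      he₂ _ (h₂ U V)) (by positivity)
  -- Averaging over the trees in the support of p; all other trees have mass zero, so they need no
  -- query bound.
  have hfin : avg D₁ - avg D₂ ≤ 1 * β := by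
    refine hasSum_le (fun t => ?_) ((havg D₁).sub (havg D₂)) (p.hasSum_toReal.mul_right β)
    rw [← mul_sub]
    by_cases ht : t ∈ p.support
    · exact mul_le_mul_of_nonneg_left ((le_abs_self _).trans (hβ t (hcost' t ht)))
        ENNReal.toReal_nonneg
    · rw [(p.apply_eq_zero_iff t).2 ht]
      simp
  linarith

/-- The slack 1 - 2ε equals half of Q^(-r), which exceeds even twice 3/16 of it; the determinant
problem needs that factor 2. -/
theorem error_bounds {Q : ℝ} (hQ : 1 ≤ Q) {r : ℝ} (hr : 0 ≤ r) :
    0 ≤ 1 / 2 - 1 / (4 * Q ^ r) ∧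
      2 * (3 / 16 * (1 / Q ^ r)) < 1 - 2 * (1 / 2 - 1 / (4 * Q ^ r)) := by
  have h1 : 1 ≤ Q ^ r := Real.one_le_rpow hQ hr
  have h2 : 1 / Q ^ r ≤ 1 := by rw [div_le_one (by linarith)]; exact h1
  have h3 : 0 < 1 / Q ^ r := by positivity
  have h4 : 1 / (4 * Q ^ r) = 1 / 4 * (1 / Q ^ r) := by field_simp
  rw [h4]
  constructor <;> linarith

/-- Coordinate inclusions place an R × R matrix in an n × m one without changing its rank, so rank R
becomes full rank. -/
theorem lt_BLQ_rankFun {n m R r q : ℕ} (hR : R ≤ min n m) (hr : r < R) (hq : 3600 * q ≤ r ^ 2) :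
    q < BLQ (1 / 2 - 1 / (4 * (Fintype.card F : ℝ) ^ ((r : ℝ) / 3))) (rankFun F n m r R) := by
  have hQ : (1 : ℝ) ≤ Fintype.card F := by exact_mod_cast Fintype.card_pos
  have hb := error_bounds hQ (r := (r : ℝ) / 3) (by positivity)
  let e : Fin R → Fin n := Fin.castLE (by omega)
  let e' : Fin R → Fin m := Fin.castLE (by omega)
  let P : Matrix (Fin n) (Fin R) F := (1 : Matrix (Fin n) (Fin n) F).submatrix id e
  let P' : Matrix (Fin R) (Fin m) F := (1 : Matrix (Fin m) (Fin m) F).submatrix e' id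
  have hrank : ∀ M : Matrix (Fin R) (Fin R) F, (P * M * P').rank = M.rank := by
    intro M
    refine le_antisymm ((rank_mul_le_left _ _).trans (rank_mul_le_right _ _)) ?_
    have h1 : Pᵀ * P = 1 := by
      ext i j
      simp [P, e, mul_apply, one_apply, Fin.castLE_inj]
    have h2 : P' * P'ᵀ = 1 := by
      ext i j
      simp [P', e', mul_apply, one_apply, Fin.castLE_inj]
    calc M.rank = (Pᵀ * (P * M * P' * P'ᵀ)).rank := by
          congr 1
          rw [Matrix.mul_assoc _ P', h2, Matrix.mul_one, ← Matrix.mul_assoc, h1, Matrix.one_mul]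
      _ ≤ _ := (rank_mul_le_right _ _).trans (rank_mul_le_left _ _)
  refine lt_BLQ (β := 3 / 16 * (1 / (Fintype.card F : ℝ) ^ ((r : ℝ) / 3))) hb.1 P P'
    (partialOne F R r) 1 (fun U V => ?_) (fun U V => ?_) (fun t ht => ?_) ?_
  · rw [rankFun, hrank, rank_specialLinearGroup_mul_mul, rank_partialOne hr.le, if_pos rfl]
  · rw [rankFun, hrank, rank_specialLinearGroup_mul_mul, rank_one, Fintype.card_fin,
      if_neg hr.ne', if_pos rfl]
  · rw [abs_sub_comm]
    exact abs_orbitProb_sub_orbitProb_le hr t hq ht P P' (by simp)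
  · have : 0 < 1 / (Fintype.card F : ℝ) ^ ((r : ℝ) / 3) := by positivity
    linarith [hb.2]

theorem lt_BLQ_rankDetFun {n r q : ℕ} {a : F} (ha : a ≠ 0) (hr : r < n) (hq : 3600 * q ≤ r ^ 2) :
    q < BLQ (1 / 2 - 1 / (4 * (Fintype.card F : ℝ) ^ ((r : ℝ) / 3))) (rankDetFun n r a) := by
  have hQ : (1 : ℝ) ≤ Fintype.card F := by exact_mod_cast Fintype.card_pos
  have hb := error_bounds hQ (r := (r : ℝ) / 3) (by positivity)
  obtain ⟨E, hE⟩ := exists_det_eq (by omega : 0 < n) a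
  have hEr : E.rank = n := by
    rw [rank_of_det_ne_zero (by rwa [hE]), Fintype.card_fin]
  refine lt_BLQ (β := 3 / 16 * (1 / (Fintype.card F : ℝ) ^ ((r : ℝ) / 3))) hb.1 1 1
    (partialOne F n r) E (fun U V => ?_) (fun U V => ?_) (fun t ht => ?_) ?_
  · rw [rankDetFun, Matrix.one_mul, Matrix.mul_one, rank_specialLinearGroup_mul_mul,
      rank_partialOne hr.le, if_pos rfl]
  · rw [rankDetFun, Matrix.one_mul, Matrix.mul_one, rank_specialLinearGroup_mul_mul, hEr,
      if_neg hr.ne', det_specialLinearGroup_mul_mul, if_pos hE]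
  · rw [abs_sub_comm]
    exact abs_orbitProb_sub_orbitProb_le hr t hq ht 1 1 hEr
  · have : 0 < 1 / (Fintype.card F : ℝ) ^ ((r : ℝ) / 3) := by positivity
    linarith [hb.2]

/-- Both determinant values are compared with the same singular reference of rank r, which itself
represents the value 0; the triangle inequality doubles the advantage. -/
theorem lt_BLQ_detFun {r q : ℕ} {a b : F} (hab : a ≠ b) (hq : 3600 * q ≤ r ^ 2) :
    q < BLQ (1 / 2 - 1 / (4 * (Fintype.card F : ℝ) ^ ((r : ℝ) / 3))) (detFun (r + 1) a b) := by
  have hQ : (1 : ℝ) ≤ Fintype.card F := by exact_mod_cast Fintype.card_pos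
  have hb := error_bounds hQ (r := (r : ℝ) / 3) (by positivity)
  have key : ∀ d : F, ∃ D : Matrix (Fin (r + 1)) (Fin (r + 1)) F, D.det = d ∧
      ∀ t : BilinearAlg F (r + 1) (r + 1), (∀ X, t.numQueries X ≤ q) →
        |orbitProb t 1 1 D - orbitProb t 1 1 (partialOne F (r + 1) r)| ≤
          3 / 16 * (1 / (Fintype.card F : ℝ) ^ ((r : ℝ) / 3)) := by
    intro d
    by_cases hd : d = 0
    · refine ⟨partialOne F (r + 1) r, ?_, fun t _ => ?_⟩
      · by_contra h
        have h1 := rank_of_det_ne_zero (hd ▸ h)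
        rw [rank_partialOne (Nat.le_succ r), Fintype.card_fin] at h1
        omega
      · rw [sub_self, abs_zero]
        positivity
    · obtain ⟨E, hE⟩ := exists_det_eq r.succ_pos d
      refine ⟨E, hE, fun t ht => abs_orbitProb_sub_orbitProb_le r.lt_succ_self t hq ht 1 1 ?_⟩
      rw [rank_of_det_ne_zero (by rwa [hE]), Fintype.card_fin]
  obtain ⟨D₁, hD₁, hD₁'⟩ := key a
  obtain ⟨D₂, hD₂, hD₂'⟩ := key b
  refine lt_BLQ (β := 2 * (3 / 16 * (1 / (Fintype.card F : ℝ) ^ ((r : ℝ) / 3)))) hb.1 1 1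
    D₁ D₂ (fun U V => ?_) (fun U V => ?_) (fun t ht => ?_) hb.2
  · rw [detFun, Matrix.one_mul, Matrix.mul_one, det_specialLinearGroup_mul_mul, hD₁, if_pos rfl]
  · rw [detFun, Matrix.one_mul, Matrix.mul_one, det_specialLinearGroup_mul_mul, hD₂,
      if_neg hab.symm, if_pos rfl]
  · have h1 := abs_le.1 (hD₁' t ht)
    have h2 := abs_le.1 (hD₂' t ht)
    rw [abs_le]
    constructor <;> linarith [h1.1, h1.2, h2.1, h2.2]

/-- Take q = ⌊r²/3600⌋; the strict inequality supplies the + 1. -/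
theorem sq_add_one_le_of_forall_lt {r B : ℕ} (h : ∀ q, 3600 * q ≤ r ^ 2 → q < B) :
    (r : ℝ) ^ 2 + 1 ≤ 3600 * B := by
  have h1 := h (r ^ 2 / 3600) (Nat.mul_div_le _ _)
  have h2 : r ^ 2 + 1 ≤ 3600 * B := by omega
  exact_mod_cast h2

end QueryComplexity

theorem theorem1p15 :
    ∃ c : ℝ, 0 < c ∧ ∀ (F : Type*) [Field F] [Finite F],
      (∀ n m R r : ℕ, R ≤ min n m → r < R →
        c * ((r : ℝ) ^ 2 + 1) ≤
          (BLQ (1 / 2 - 1 / (4 * (Nat.card F : ℝ) ^ ((r : ℝ) / 3))) (rankFun F n m r R) : ℝ)) ∧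
      (∀ (a b : F) (n : ℕ), a ≠ b → 1 ≤ n →
        c * (n : ℝ) ^ 2 ≤
          (BLQ (1 / 2 - 1 / (4 * (Nat.card F : ℝ) ^ (((n : ℝ) - 1) / 3))) (detFun n a b) : ℝ)) ∧
      (∀ (a : F) (n r : ℕ), a ≠ 0 → r < n →
        c * ((r : ℝ) ^ 2 + 1) ≤
          (BLQ (1 / 2 - 1 / (4 * (Nat.card F : ℝ) ^ ((r : ℝ) / 3))) (rankDetFun n r a) : ℝ)) := by
  -- Half of 1/3600, since the determinant problem with n = r + 1 uses (r + 1)² ≤ 2(r² + 1).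
  refine ⟨1 / 7200, by norm_num, fun F _ _ => ?_⟩
  classical
  have := Fintype.ofFinite F
  rw [Nat.card_eq_fintype_card]
  refine ⟨fun n m R r hR hr => ?_, fun a b n hab hn => ?_, fun a n r ha hr => ?_⟩
  · have h := sq_add_one_le_of_forall_lt fun q hq => lt_BLQ_rankFun (F := F) hR hr hq
    have : (0 : ℝ) ≤ (r : ℝ) ^ 2 := by positivity
    linarith
  · obtain ⟨r, rfl⟩ : ∃ r, n = r + 1 := ⟨n - 1, by omega⟩
    have h := sq_add_one_le_of_forall_lt fun q hq => lt_BLQ_detFun (r := r) hab hq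
    push_cast
    rw [add_sub_cancel_right]
    nlinarith [sq_nonneg ((r : ℝ) - 1)]
  · have h := sq_add_one_le_of_forall_lt fun q hq => lt_BLQ_rankDetFun ha hr hq
    have : (0 : ℝ) ≤ (r : ℝ) ^ 2 := by positivity
    linarith
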